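/- Consider the dual-NOPA coherent feedback network with oscillator modes $a_1,b_1,a_2,b_2$, driven by independent vacuum fields $\xi_{in,a,1},\xi_{in,b,2},\xi_{loss,a,i},\xi_{loss,b,i},\xi_{BS,i}$ ($i=1,2$), with path phase shifts $\theta_1,\theta_2$ and output phase shifts $\phi_1,\phi_2$: $$\dot a_1=-\tfrac{\gamma+\kappa}{2}a_1+\tfrac{\epsilon}{2}b_1^*-\sqrt\gamma\,\xi_{in,a,1}-\sqrt\kappa\,\xi_{loss,a,1},$$ $$\dot b_1=-\tfrac{\gamma+\kappa}{2}b_1+\tfrac{\epsilon}{2}a_1^*-\alpha\gamma e^{i\theta_2}b_2-\alpha\sqrt\gamma e^{i\theta_2}\xi_{in,b,2}-\sqrt\kappa\,\xi_{loss,b,1}-\beta\sqrt\gamma\,\xi_{BS,2},$$ $$\dot a_2=-\tfrac{\gamma+\kappa}{2}a_2+\tfrac{\epsilon}{2}b_2^*-\alpha\gamma e^{i\theta_1}a_1-\alpha\sqrt\gamma e^{i\theta_1}\xi_{in,a,1}-\sqrt\kappa\,\xi_{loss,a,2}-\beta\sqrt\gamma\,\xi_{BS,1},$$ $$\dot b_2=-\tfrac{\gamma+\kappa}{2}b_2+\tfrac{\epsilon}{2}a_2^*-\sqrt\gamma\,\xi_{in,b,2}-\sqrt\kappa\,\xi_{loss,b,2},$$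 $$\xi_{out,b,1}=e^{i\phi_1}\bigl(\sqrt\gamma\, b_1+\alpha\sqrt\gamma e^{i\theta_2}b_2+\alpha e^{i\theta_2}\xi_{in,b,2}+\beta\,\xi_{BS,2}\bigr),$$ $$\xi_{out,a,2}=e^{i\phi_2}\bigl(\sqrt\gamma\, a_2+\alpha\sqrt\gamma e^{i\theta_1}a_1+\alpha e^{i\theta_1}\xi_{in,a,1}+\beta\,\xi_{BS,1}\bigr).$$ Here $\epsilon=x\gamma_r$, $\gamma=\gamma_r/y$, $\kappa=\frac{3\times10^6}{\sqrt2\times0.6}\,x$, $\gamma_r=7.2\times10^7$, $\beta=\sqrt{1-\alpha^2}$, with $0<x,y,\alpha\le 1$. In the quadratures $c^q=c+c^*$, $c^p=(c-c^*)/i$ this is a real linear system $\dot z=Az+B\xi$, $\xi_{out}=Cz+D\xi$, where $\xi_{out}=(\xi^q_{out,b,1},\xi^p_{out,b,1},\xi^q_{out,a,2},\xi^p_{out,a,2})^T$ and $A=A(\theta_1,\theta_2)$. It is called stable if all eigenvalues of $A$ have negative real part. Put $H=D-CA^{-1}B$, $H_1=[1\ 0\ 1\ 0]H$, $H_2=[0\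 1\ 0\ {-1}]H$. The zero-frequency two-mode squeezing spectra are $V_+=\mathrm{Tr}[H_1^*H_1]$ and $V_-=\mathrm{Tr}[H_2^*H_2]$. Let $V_\pm^{ps}(\theta_1,\theta_2)$ be their values at $\phi_1=\phi_2=0$, and $V_\pm^{nops}=V_\pm^{ps}(0,0)$. For given $\theta_1,\theta_2$, the outputs are called EPR entangled (at zero frequency) if $V_++V_-<4$ for some $\phi_1,\phi_2\in(-\pi,\pi]$. (1) Let $0<x,y,\alpha\le1$ and $\theta_1,\theta_2\in(-\pi,\pi]$, and assume that $A(0,0)$ is invertible (in particular, this holds if the system without phase shifts is stable). Then $$V_+^{ps}(\theta_1,\theta_2)\ge V_+^{nops},\qquad V_-^{ps}(\theta_1,\theta_2)\ge V_-^{nops},$$ and in each of the two inequalities equality holds if and only if $\theta_1=\theta_2=0$. (2) The phase shifts can destroy the entanglement: there are $x,y,\alpha\in(0,1]$ and nonzero $\theta_1,\theta_2\in(-\pi,\pi]$ such that the system is stable both with phase shifts $\theta_1,\theta_2$ and without phase shifts, its outputs are EPR entangled without phase shifts, and they are not EPR entangled with phase shifts $\theta_1,\theta_2$. -/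

import Mathlib

open scoped Matrix

noncomputable section

namespace DualNOPA

/-- Physical parameters of the network: pump coupling `ε`, mirror damping rate `γ`, amplification
loss rate `κ`, and transmission rate `α` of the beamsplitter in each path. -/
structure Params where
  ε : ℝ
  γ : ℝ
  κ : ℝ
  α : ℝ

/-- Reflection rate `β = √(1 - α²)`. -/
def Params.β (p : Params) : ℝ := √(1 - p.α ^ 2)

/-- Reference mirror transmissivity `γ_r = 7.2 × 10⁷` Hz. -/
def gammaRef : ℝ := 72000000

/-- The parametrization `ε = x γ_r`, `γ = γ_r / y`, `κ = 3 × 10⁶ / (√2 × 0.6) x`. -/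
def params (x y α : ℝ) : Params where
  ε := x * gammaRef
  γ := gammaRef / y
  κ := 3 * 10 ^ 6 / (√2 * (6 / 10)) * x
  α := α

/-- Drift matrix, in the quadratures `(a₁^q, a₁^p, b₁^q, b₁^p, a₂^q, a₂^p, b₂^q, b₂^p)`:
`ȧ₁ = -(γ+κ)/2 a₁ + ε/2 b₁* + …`, `ḃ₁ = -(γ+κ)/2 b₁ + ε/2 a₁* - αγ e^{iθ₂} b₂ + …`,
`ȧ₂ = -(γ+κ)/2 a₂ + ε/2 b₂* - αγ e^{iθ₁} a₁ + …`, `ḃ₂ = -(γ+κ)/2 b₂ + ε/2 a₂* + …`. -/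
def matA (p : Params) (θ₁ θ₂ : ℝ) : Matrix (Fin 8) (Fin 8) ℝ :=
  let d : ℝ := -((p.γ + p.κ) / 2)
  let e : ℝ := p.ε / 2
  let r : ℝ := p.α * p.γ
  !![d, 0, e, 0, 0, 0, 0, 0;
     0, d, 0, -e, 0, 0, 0, 0;
     e, 0, d, 0, 0, 0, -(r * Real.cos θ₂), r * Real.sin θ₂;
     0, -e, 0, d, 0, 0, -(r * Real.sin θ₂), -(r * Real.cos θ₂);
     -(r * Real.cos θ₁), r * Real.sin θ₁, 0, 0, d, 0, e, 0;
     -(r * Real.sin θ₁), -(r * Real.cos θ₁), 0, 0, 0, d, 0, -e;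
     0, 0, 0, 0, e, 0, d, 0;
     0, 0, 0, 0, 0, -e, 0, d]

/-- Input matrix, with the rows of `matA`. Columns: the quadratures (`q`, then `p`) of the vacuum
fields `ξ_{in,a,1}`, `ξ_{in,b,2}`, `ξ_{loss,a,1}`, `ξ_{loss,b,1}`, `ξ_{loss,a,2}`, `ξ_{loss,b,2}`,
`ξ_{BS,1}`, `ξ_{BS,2}`. The input terms are `-√γ ξ_{in,a,1} - √κ ξ_{loss,a,1}` for `a₁`,
`-α√γ e^{iθ₂} ξ_{in,b,2} - √κ ξ_{loss,b,1} - β√γ ξ_{BS,2}` for `b₁`,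
`-α√γ e^{iθ₁} ξ_{in,a,1} - √κ ξ_{loss,a,2} - β√γ ξ_{BS,1}` for `a₂`,
and `-√γ ξ_{in,b,2} - √κ ξ_{loss,b,2}` for `b₂`. -/
def matB (p : Params) (θ₁ θ₂ : ℝ) : Matrix (Fin 8) (Fin 16) ℝ :=
  let g : ℝ := √p.γ
  let l : ℝ := √p.κ
  let r : ℝ := p.α * √p.γ
  let s : ℝ := p.β * √p.γ
  !![-g, 0, 0, 0, -l, 0, 0, 0, 0, 0, 0, 0, 0, 0, 0, 0;
     0, -g, 0, 0, 0, -l, 0, 0, 0, 0, 0, 0, 0, 0, 0, 0;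
     0, 0, -(r * Real.cos θ₂), r * Real.sin θ₂, 0, 0, -l, 0, 0, 0, 0, 0, 0, 0, -s, 0;
     0, 0, -(r * Real.sin θ₂), -(r * Real.cos θ₂), 0, 0, 0, -l, 0, 0, 0, 0, 0, 0, 0, -s;
     -(r * Real.cos θ₁), r * Real.sin θ₁, 0, 0, 0, 0, 0, 0, -l, 0, 0, 0, -s, 0, 0, 0;
     -(r * Real.sin θ₁), -(r * Real.cos θ₁), 0, 0, 0, 0, 0, 0, 0, -l, 0, 0, 0, -s, 0, 0;
     0, 0, -g, 0, 0, 0, 0, 0, 0, 0, -l, 0, 0, 0, 0, 0;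
     0, 0, 0, -g, 0, 0, 0, 0, 0, 0, 0, -l, 0, 0, 0, 0]

/-- Output matrix. Rows: `(ξ_{out,b,1}^q, ξ_{out,b,1}^p, ξ_{out,a,2}^q, ξ_{out,a,2}^p)`, where
`ξ_{out,b,1} = √γ e^{iφ₁} b₁ + α√γ e^{i(θ₂+φ₁)} b₂ + α e^{i(θ₂+φ₁)} ξ_{in,b,2} + β e^{iφ₁} ξ_{BS,2}`,
`ξ_{out,a,2} = √γ e^{iφ₂} a₂ + α√γ e^{i(θ₁+φ₂)} a₁ + α e^{i(θ₁+φ₂)} ξ_{in,a,1} + β e^{iφ₂} ξ_{BS,1}`. -/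
def matC (p : Params) (θ₁ θ₂ φ₁ φ₂ : ℝ) : Matrix (Fin 4) (Fin 8) ℝ :=
  let g : ℝ := √p.γ
  let r : ℝ := p.α * √p.γ
  !![0, 0, g * Real.cos φ₁, -(g * Real.sin φ₁), 0, 0, r * Real.cos (θ₂ + φ₁), -(r * Real.sin (θ₂ + φ₁));
     0, 0, g * Real.sin φ₁, g * Real.cos φ₁, 0, 0, r * Real.sin (θ₂ + φ₁), r * Real.cos (θ₂ + φ₁);
     r * Real.cos (θ₁ + φ₂), -(r * Real.sin (θ₁ + φ₂)), 0, 0, g * Real.cos φ₂, -(g * Real.sin φ₂), 0, 0;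
     r * Real.sin (θ₁ + φ₂), r * Real.cos (θ₁ + φ₂), 0, 0, g * Real.sin φ₂, g * Real.cos φ₂, 0, 0]

/-- Feedthrough matrix, with the rows of `matC` and the columns of `matB`. -/
def matD (p : Params) (θ₁ θ₂ φ₁ φ₂ : ℝ) : Matrix (Fin 4) (Fin 16) ℝ :=
  !![0, 0, p.α * Real.cos (θ₂ + φ₁), -(p.α * Real.sin (θ₂ + φ₁)), 0, 0, 0, 0, 0, 0, 0, 0, 0, 0, p.β * Real.cos φ₁, -(p.β * Real.sin φ₁);
     0, 0, p.α * Real.sin (θ₂ + φ₁), p.α * Real.cos (θ₂ + φ₁), 0, 0, 0, 0, 0, 0, 0, 0, 0, 0, p.β * Real.sin φ₁, p.β * Real.cos φ₁;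
     p.α * Real.cos (θ₁ + φ₂), -(p.α * Real.sin (θ₁ + φ₂)), 0, 0, 0, 0, 0, 0, 0, 0, 0, 0, p.β * Real.cos φ₂, -(p.β * Real.sin φ₂), 0, 0;
     p.α * Real.sin (θ₁ + φ₂), p.α * Real.cos (θ₁ + φ₂), 0, 0, 0, 0, 0, 0, 0, 0, 0, 0, p.β * Real.sin φ₂, p.β * Real.cos φ₂, 0, 0]

/-- Zero-frequency transfer matrix `H = D - C A⁻¹ B`. -/
def transfer (p : Params) (θ₁ θ₂ φ₁ φ₂ : ℝ) : Matrix (Fin 4) (Fin 16) ℝ :=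
  matD p θ₁ θ₂ φ₁ φ₂ - matC p θ₁ θ₂ φ₁ φ₂ * (matA p θ₁ θ₂)⁻¹ * matB p θ₁ θ₂

/-- The row `[1 0 1 0]`, selecting `ξ_{out,b,1}^q + ξ_{out,a,2}^q`. -/
def rowPlus : Matrix (Fin 1) (Fin 4) ℝ :=
  !![1, 0, 1, 0]

/-- The row `[0 1 0 -1]`, selecting `ξ_{out,b,1}^p - ξ_{out,a,2}^p`. -/
def rowMinus : Matrix (Fin 1) (Fin 4) ℝ :=
  !![0, 1, 0, -1]

/-- Two-mode amplitude squeezing spectrum at zero frequency, `V₊ = Tr[H₁* H₁]`. -/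
def Vplus (p : Params) (θ₁ θ₂ φ₁ φ₂ : ℝ) : ℝ :=
  ((rowPlus * transfer p θ₁ θ₂ φ₁ φ₂)ᴴ * (rowPlus * transfer p θ₁ θ₂ φ₁ φ₂)).trace

/-- Two-mode phase squeezing spectrum at zero frequency, `V₋ = Tr[H₂* H₂]`. -/
def Vminus (p : Params) (θ₁ θ₂ φ₁ φ₂ : ℝ) : ℝ :=
  ((rowMinus * transfer p θ₁ θ₂ φ₁ φ₂)ᴴ * (rowMinus * transfer p θ₁ θ₂ φ₁ φ₂)).trace

/-- Spectra under path phase shifts `θ₁, θ₂`, without output phase shifters. -/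
def VpsPlus (p : Params) (θ₁ θ₂ : ℝ) : ℝ := Vplus p θ₁ θ₂ 0 0

/-- Spectra under path phase shifts `θ₁, θ₂`, without output phase shifters. -/
def VpsMinus (p : Params) (θ₁ θ₂ : ℝ) : ℝ := Vminus p θ₁ θ₂ 0 0

/-- Spectra without any phase shifts. -/
def VnopsPlus (p : Params) : ℝ := Vplus p 0 0 0 0

/-- Spectra without any phase shifts. -/
def VnopsMinus (p : Params) : ℝ := Vminus p 0 0 0 0

/-- Stability: the drift matrix is Hurwitz. -/
def IsStable (p : Params) (θ₁ θ₂ : ℝ) : Prop :=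
  ∀ μ ∈ spectrum ℂ ((matA p θ₁ θ₂).map Complex.ofReal), μ.re < 0

/-- The two output fields are EPR entangled at zero frequency: after rotating them by suitable
phases `ψ₁, ψ₂ ∈ (-π, π]`, the sum of the two squeezing spectra is below `4`. -/
def EPREntangled (p : Params) (θ₁ θ₂ : ℝ) : Prop :=
  ∃ ψ₁ ∈ Set.Ioc (-Real.pi) Real.pi, ∃ ψ₂ ∈ Set.Ioc (-Real.pi) Real.pi,
    Vplus p θ₁ θ₂ ψ₁ ψ₂ + Vminus p θ₁ θ₂ ψ₁ ψ₂ < 4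

end DualNOPA

end

/-! Solving `g * A = [1 0 1 0] * C` for a row `g` avoids inverting the drift matrix. Written with
complex amplitudes, the modes `a₁` and `b₂` can be eliminated; what remains is a 2×2 complex system
with diagonal `Δ` and off-diagonal entries `T` times unit phases. Its determinant `Δ² - T²
e^{i(θ₁-θ₂)}` cannot vanish when `|Δ| ≠ |T|`, so invertibility at zero phases, which gives `Δ ≠ T`,
carries over to all phases.

The noise power depends on the solution only through two quadratic invariants, and `V₊` collapses to
`(4SW/Δ) · phaseFactor + const` (`Vplus_eq`). The output phases enter only through `φ₁ + φ₂`, whence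
`V₋ = V₊`. In the physical range `S`, `W`, `Δ` and `T` are positive, so part (1) says that the phase
factor has its unique minimum at `θ₁ = θ₂ = 0` (`phaseFactor_sub_one`). For part (2), `θ₁ - θ₂ = π`
makes the phase factor independent of the output phases, so that no output phase shifter can restore
the entanglement. -/

noncomputable section

namespace DualNOPA

/-! ### Reduction of the spectra to a linear system -/

/-- If the row vector `g` (given by its quadrature coefficients) solves
`g * A = [1 0 1 0] * C` up to the common factor `√γ`, then `V₊` is the sum of the squared moduli of
the coefficients of the vacuum fields. -/
theorem Vplus_eq_of_solution (p : Params) (θ₁ θ₂ φ₁ φ₂ x₁ y₁ x₂ y₂ x₃ y₃ x₄ y₄ : ℝ)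
    (hγ : 0 ≤ p.γ) (hκ : 0 ≤ p.κ) (hα : p.α ^ 2 ≤ 1) (hA : IsUnit (matA p θ₁ θ₂))
    (h₁ : -((p.γ + p.κ) / 2) * x₁ + p.ε / 2 * x₂
      - p.α * p.γ * (Real.cos θ₁ * x₃ - Real.sin θ₁ * y₃) = p.α * Real.cos (θ₁ + φ₂))
    (h₁' : -((p.γ + p.κ) / 2) * y₁ + p.ε / 2 * y₂
      - p.α * p.γ * (Real.sin θ₁ * x₃ + Real.cos θ₁ * y₃) = p.α * Real.sin (θ₁ + φ₂))
    (h₂ : p.ε / 2 * x₁ - (p.γ + p.κ) / 2 * x₂ = Real.cos φ₁)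
    (h₂' : p.ε / 2 * y₁ - (p.γ + p.κ) / 2 * y₂ = -Real.sin φ₁)
    (h₃ : p.ε / 2 * x₄ - (p.γ + p.κ) / 2 * x₃ = Real.cos φ₂)
    (h₃' : p.ε / 2 * y₄ - (p.γ + p.κ) / 2 * y₃ = Real.sin φ₂)
    (h₄ : -((p.γ + p.κ) / 2) * x₄ + p.ε / 2 * x₃
      - p.α * p.γ * (Real.cos θ₂ * x₂ + Real.sin θ₂ * y₂) = p.α * Real.cos (θ₂ + φ₁))
    (h₄' : -((p.γ + p.κ) / 2) * y₄ + p.ε / 2 * y₃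
      - p.α * p.γ * (Real.cos θ₂ * y₂ - Real.sin θ₂ * x₂) = -(p.α * Real.sin (θ₂ + φ₁))) :
    Vplus p θ₁ θ₂ φ₁ φ₂ =
      ((p.γ - p.κ) / 2 * x₁ + p.ε / 2 * x₂) ^ 2 + ((p.γ - p.κ) / 2 * y₁ + p.ε / 2 * y₂) ^ 2
      + ((p.γ - p.κ) / 2 * x₄ + p.ε / 2 * x₃) ^ 2 + ((p.γ - p.κ) / 2 * y₄ + p.ε / 2 * y₃) ^ 2
      + p.γ * p.κ * (x₁ ^ 2 + y₁ ^ 2 + x₂ ^ 2 + y₂ ^ 2 + x₃ ^ 2 + y₃ ^ 2 + x₄ ^ 2 + y₄ ^ 2)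
      + (1 - p.α ^ 2) * ((Real.cos φ₁ + p.γ * x₂) ^ 2 + (p.γ * y₂ - Real.sin φ₁) ^ 2
        + (Real.cos φ₂ + p.γ * x₃) ^ 2 + (Real.sin φ₂ + p.γ * y₃) ^ 2) := by
  have hsγ : √p.γ ^ 2 = p.γ := Real.sq_sqrt hγ
  have hsκ : √p.κ ^ 2 = p.κ := Real.sq_sqrt hκ
  have hβ : p.β ^ 2 = 1 - p.α ^ 2 := Real.sq_sqrt (by linarith)
  -- The pump couples each mode to a conjugate; flipping the `p`-signs of `a₁` and `a₂` makes that
  -- coupling look the same in both quadratures.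
  let G : Matrix (Fin 1) (Fin 8) ℝ :=
    √p.γ • !![x₁, -y₁, x₂, y₂, x₃, -y₃, x₄, y₄]
  have hG : G * matA p θ₁ θ₂ = rowPlus * matC p θ₁ θ₂ φ₁ φ₂ := by
    ext i j
    fin_cases i
    fin_cases j <;>
      simp [G, matA, matC, rowPlus, Matrix.mul_apply, Fin.sum_univ_succ]
    · linear_combination √p.γ * h₁
    · linear_combination -√p.γ * h₁'
    · linear_combination √p.γ * h₂
    · linear_combination √p.γ * h₂'
    · linear_combination √p.γ * h₃
    · linear_combination -√p.γ * h₃'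
    · linear_combination √p.γ * h₄
    · linear_combination √p.γ * h₄'
  have hH : rowPlus * transfer p θ₁ θ₂ φ₁ φ₂ =
      !![(p.γ - p.κ) / 2 * x₁ + p.ε / 2 * x₂, -((p.γ - p.κ) / 2 * y₁ + p.ε / 2 * y₂),
        (p.γ - p.κ) / 2 * x₄ + p.ε / 2 * x₃, (p.γ - p.κ) / 2 * y₄ + p.ε / 2 * y₃,
        √p.γ * √p.κ * x₁, -(√p.γ * √p.κ * y₁), √p.γ * √p.κ * x₂, √p.γ * √p.κ * y₂,
        √p.γ * √p.κ * x₃, -(√p.γ * √p.κ * y₃), √p.γ * √p.κ * x₄, √p.γ * √p.κ * y₄,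
        p.β * (Real.cos φ₂ + p.γ * x₃), -(p.β * (Real.sin φ₂ + p.γ * y₃)),
        p.β * (Real.cos φ₁ + p.γ * x₂), p.β * (p.γ * y₂ - Real.sin φ₁)] := by
    have hinv : rowPlus * matC p θ₁ θ₂ φ₁ φ₂ * (matA p θ₁ θ₂)⁻¹ = G := by
      rw [← hG, Matrix.mul_nonsing_inv_cancel_right _ _ ((Matrix.isUnit_iff_isUnit_det _).1 hA)]
    have hsplit : rowPlus * transfer p θ₁ θ₂ φ₁ φ₂ =
        rowPlus * matD p θ₁ θ₂ φ₁ φ₂ - G * matB p θ₁ θ₂ := by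
      rw [transfer, Matrix.mul_sub, ← hinv]
      simp only [Matrix.mul_assoc]
    rw [hsplit]
    clear hsplit hinv hG
    ext i j
    fin_cases i
    fin_cases j <;>
      simp [G, matB, matD, rowPlus]
    -- The equations for `a₁` and `b₂` absorb the feedthrough and path terms in `α`, leaving `γ -
    -- (γ+κ)/2 = (γ-κ)/2`.
    · linear_combination (x₁ + p.α * (Real.cos θ₁ * x₃ - Real.sin θ₁ * y₃)) * hsγ - h₁
    · linear_combination -(y₁ + p.α * (Real.sin θ₁ * x₃ + Real.cos θ₁ * y₃)) * hsγ + h₁'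
    · linear_combination (x₄ + p.α * (Real.cos θ₂ * x₂ + Real.sin θ₂ * y₂)) * hsγ - h₄
    · linear_combination (y₄ + p.α * (Real.cos θ₂ * y₂ - Real.sin θ₂ * x₂)) * hsγ - h₄'
    · ring
    · ring
    · ring
    · ring
    · ring
    · ring
    · ring
    · ring
    · linear_combination p.β * x₃ * hsγ
    · linear_combination -p.β * y₃ * hsγ
    · linear_combination p.β * x₂ * hsγ
    · linear_combination p.β * y₂ * hsγ
  rw [Vplus, hH, Matrix.trace_mul_comm, Matrix.trace_fin_one, Matrix.mul_apply]
  simp [Fin.sum_univ_succ]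
  have hγκ : (√p.γ * √p.κ) ^ 2 = p.γ * p.κ := by rw [mul_pow, hsγ, hsκ]
  linear_combination
    (x₁ ^ 2 + y₁ ^ 2 + x₂ ^ 2 + y₂ ^ 2 + x₃ ^ 2 + y₃ ^ 2 + x₄ ^ 2 + y₄ ^ 2) * hγκ
    + ((Real.cos φ₁ + p.γ * x₂) ^ 2 + (p.γ * y₂ - Real.sin φ₁) ^ 2
        + (Real.cos φ₂ + p.γ * x₃) ^ 2 + (Real.sin φ₂ + p.γ * y₃) ^ 2) * hβ

/-- A `p`-quadrature is the `q`-quadrature after a quarter turn; the minus sign in `[0 1 0 -1]`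
makes the second turn opposite to the first. -/
theorem Vminus_eq_Vplus (p : Params) (θ₁ θ₂ φ₁ φ₂ : ℝ) :
    Vminus p θ₁ θ₂ φ₁ φ₂ = Vplus p θ₁ θ₂ (φ₁ - Real.pi / 2) (φ₂ + Real.pi / 2) := by
  have hC : rowMinus * matC p θ₁ θ₂ φ₁ φ₂ =
      rowPlus * matC p θ₁ θ₂ (φ₁ - Real.pi / 2) (φ₂ + Real.pi / 2) := by
    ext i j
    fin_cases i
    fin_cases j <;>
      simp [matC, rowPlus, rowMinus, Matrix.mul_apply, Fin.sum_univ_succ, ← add_assoc,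
        ← add_sub_assoc, Real.cos_add_pi_div_two, Real.sin_add_pi_div_two,
        Real.cos_sub_pi_div_two, Real.sin_sub_pi_div_two]
  have hD : rowMinus * matD p θ₁ θ₂ φ₁ φ₂ =
      rowPlus * matD p θ₁ θ₂ (φ₁ - Real.pi / 2) (φ₂ + Real.pi / 2) := by
    ext i j
    fin_cases i
    fin_cases j <;>
      simp [matD, rowPlus, rowMinus, Matrix.mul_apply, Fin.sum_univ_succ, ← add_assoc,
        ← add_sub_assoc, Real.cos_add_pi_div_two, Real.sin_add_pi_div_two,
        Real.cos_sub_pi_div_two, Real.sin_sub_pi_div_two]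
  have hT : rowMinus * transfer p θ₁ θ₂ φ₁ φ₂ =
      rowPlus * transfer p θ₁ θ₂ (φ₁ - Real.pi / 2) (φ₂ + Real.pi / 2) := by
    simp only [transfer, Matrix.mul_sub, ← Matrix.mul_assoc, hC, hD]
  rw [Vminus, Vplus, hT]

/-! ### Spectrum, invertibility and stability of the drift matrix -/

/-- Taking moduli removes the phases `w`, `w'` and leaves a real symmetric system with determinant
`‖z‖² - |T|²`. -/
theorem eq_zero_of_unimodular_pair {z g g' w w' : ℂ} {T : ℝ} (hw : ‖w‖ = 1) (hw' : ‖w'‖ = 1)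
    (hz : ‖z‖ ≠ |T|) (h : z * g + T * w * g' = 0) (h' : z * g' + T * w' * g = 0) :
    g = 0 ∧ g' = 0 := by
  have hn : ‖z‖ * ‖g‖ = |T| * ‖g'‖ := by
    have := congrArg norm (eq_neg_of_add_eq_zero_left h)
    simpa [hw] using this
  have hn' : ‖z‖ * ‖g'‖ = |T| * ‖g‖ := by
    have := congrArg norm (eq_neg_of_add_eq_zero_left h')
    simpa [hw'] using this
  have hsq : ‖z‖ ^ 2 - |T| ^ 2 ≠ 0 := fun h0 =>
    hz ((sq_eq_sq₀ (norm_nonneg _) (abs_nonneg _)).1 (sub_eq_zero.1 h0))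
  constructor <;> rw [← norm_eq_zero] <;> refine (mul_eq_zero.1 ?_).resolve_left hsq
  · linear_combination ‖z‖ * hn + |T| * hn'
  · linear_combination ‖z‖ * hn' + |T| * hn

/-- Every eigenvalue `μ` of the drift matrix satisfies `|((γ+κ)/2 + μ)² - (ε/2)²| = αγε/2`. -/
theorem norm_eq_of_mem_spectrum (p : Params) (θ₁ θ₂ : ℝ) (hε : p.ε ≠ 0) {μ : ℂ}
    (hμ : μ ∈ spectrum ℂ ((matA p θ₁ θ₂).map Complex.ofReal)) :
    ‖((p.γ + p.κ) / 2 + μ) ^ 2 - ((p.ε : ℂ) / 2) ^ 2‖ = |p.α * p.γ * (p.ε / 2)| := by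
  by_contra hne
  apply hμ
  change IsUnit _
  rw [← Matrix.vecMul_injective_iff_isUnit]
  rw [← Matrix.coe_vecMulLinear]
  refine (injective_iff_map_eq_zero _).2 fun v hv => ?_
  have hcol : ∀ j, (v ᵥ* (algebraMap ℂ (Matrix (Fin 8) (Fin 8) ℂ) μ -
      (matA p θ₁ θ₂).map Complex.ofReal)) j = 0 := fun j => congrFun hv j
  have e0 := hcol 0
  have e1 := hcol 1
  have e2 := hcol 2
  have e3 := hcol 3
  have e4 := hcol 4
  have e5 := hcol 5
  have e6 := hcol 6
  have e7 := hcol 7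
  clear hcol hv
  simp [Matrix.vecMul, dotProduct, Fin.sum_univ_succ, matA, Matrix.algebraMap_matrix_apply,
    Matrix.sub_apply] at e0 e1 e2 e3 e4 e5 e6 e7
  set n : ℂ := μ + (p.γ + p.κ) / 2 with hn
  have hnorm : ‖n ^ 2 - ((p.ε : ℂ) / 2) ^ 2‖ ≠ |p.α * p.γ * (p.ε / 2)| := by
    rwa [hn, add_comm μ]
  have hw : ∀ θ : ℝ, ‖Complex.cos θ + Complex.sin θ * Complex.I‖ = 1 := fun θ => by
    rw [← Complex.exp_mul_I, Complex.norm_exp_ofReal_mul_I]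
  have hw' : ∀ θ : ℝ, ‖Complex.cos θ - Complex.sin θ * Complex.I‖ = 1 := fun θ => by
    simpa [sub_eq_add_neg] using hw (-θ)
  have hI := Complex.I_sq
  -- Eliminating the `a₁` and `b₂` components of a left null vector leaves a closed system for `b₁`
  -- and `a₂`.
  have f2 : (n ^ 2 - ((p.ε : ℂ) / 2) ^ 2) * v 2
      + p.α * p.γ * (p.ε / 2) * (Complex.cos θ₁ * v 4 + Complex.sin θ₁ * v 5) = 0 := by
    linear_combination (p.ε : ℂ) / 2 * e0 + n * e2
  have f3 : (n ^ 2 - ((p.ε : ℂ) / 2) ^ 2) * v 3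
      + p.α * p.γ * (p.ε / 2) * (Complex.sin θ₁ * v 4 - Complex.cos θ₁ * v 5) = 0 := by
    linear_combination -(p.ε : ℂ) / 2 * e1 + n * e3
  have f4 : (n ^ 2 - ((p.ε : ℂ) / 2) ^ 2) * v 4
      + p.α * p.γ * (p.ε / 2) * (Complex.cos θ₂ * v 2 + Complex.sin θ₂ * v 3) = 0 := by
    linear_combination (p.ε : ℂ) / 2 * e6 + n * e4
  have f5 : (n ^ 2 - ((p.ε : ℂ) / 2) ^ 2) * v 5
      + p.α * p.γ * (p.ε / 2) * (Complex.sin θ₂ * v 2 - Complex.cos θ₂ * v 3) = 0 := by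
    linear_combination -(p.ε : ℂ) / 2 * e7 + n * e5
  -- The couplings are plane reflections; pairing `v 2 ± i v 3` with `v 4 ∓ i v 5` turns them into
  -- multiplication by unit complex numbers.
  obtain ⟨g2, g3⟩ := eq_zero_of_unimodular_pair (g := v 2 + v 3 * Complex.I)
    (g' := v 4 - v 5 * Complex.I) (hw θ₁) (hw' θ₂) hnorm
    (by push_cast
        linear_combination f2 + Complex.I * f3
          - (p.α * p.γ * (p.ε / 2) * Complex.sin θ₁ * v 5) * hI)
    (by push_cast
        linear_combination f4 - Complex.I * f5
          - (p.α * p.γ * (p.ε / 2) * Complex.sin θ₂ * v 3) * hI)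
  obtain ⟨g2', g3'⟩ := eq_zero_of_unimodular_pair (g := v 2 - v 3 * Complex.I)
    (g' := v 4 + v 5 * Complex.I) (hw' θ₁) (hw θ₂) hnorm
    (by push_cast
        linear_combination f2 - Complex.I * f3
          - (p.α * p.γ * (p.ε / 2) * Complex.sin θ₁ * v 5) * hI)
    (by push_cast
        linear_combination f4 + Complex.I * f5
          - (p.α * p.γ * (p.ε / 2) * Complex.sin θ₂ * v 3) * hI)
  have v2 : v 2 = 0 := by linear_combination (g2 + g2') / 2
  have v3 : v 3 = 0 := by linear_combination -Complex.I * (g2 - g2') / 2 + v 3 * hI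
  have v4 : v 4 = 0 := by linear_combination (g3 + g3') / 2
  have v5 : v 5 = 0 := by linear_combination Complex.I * (g3 - g3') / 2 + v 5 * hI
  have v0 : v 0 = 0 := by simpa [v2, hε] using e2
  have v1 : v 1 = 0 := by simpa [v3, hε] using e3
  have v6 : v 6 = 0 := by simpa [v4, hε] using e4
  have v7 : v 7 = 0 := by simpa [v5, hε] using e5
  ext j
  fin_cases j <;> assumption

theorem isUnit_matA (p : Params) (θ₁ θ₂ : ℝ) (hε : p.ε ≠ 0)
    (h : |((p.γ + p.κ) / 2) ^ 2 - (p.ε / 2) ^ 2| ≠ |p.α * p.γ * (p.ε / 2)|) :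
    IsUnit (matA p θ₁ θ₂) := by
  have h0 : (0 : ℂ) ∉ spectrum ℂ ((matA p θ₁ θ₂).map Complex.ofReal) := fun hmem => by
    refine h (Eq.trans ?_ (norm_eq_of_mem_spectrum p θ₁ θ₂ hε hmem))
    rw [← Real.norm_eq_abs, ← Complex.norm_real]
    push_cast
    simp
  rw [spectrum.zero_notMem_iff, Matrix.isUnit_iff_isUnit_det, isUnit_iff_ne_zero] at h0
  rw [Matrix.isUnit_iff_isUnit_det, isUnit_iff_ne_zero]
  intro hdet
  apply h0
  have := RingHom.map_det Complex.ofRealHom (matA p θ₁ θ₂)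
  rw [hdet, map_zero] at this
  exact this.symm

/-- An eigenvalue with `Re μ ≥ 0` would have `|(γ+κ)/2 + μ| ≥ (γ+κ)/2`, forcing the modulus in
`norm_eq_of_mem_spectrum` above the loop gain. The phases play no role. -/
theorem isStable_of_lt (p : Params) (θ₁ θ₂ : ℝ) (hε : p.ε ≠ 0) (hd : 0 ≤ (p.γ + p.κ) / 2)
    (h : |p.α * p.γ * (p.ε / 2)| < ((p.γ + p.κ) / 2) ^ 2 - (p.ε / 2) ^ 2) :
    IsStable p θ₁ θ₂ := by
  intro μ hμ
  have hnorm := norm_eq_of_mem_spectrum p θ₁ θ₂ hε hμ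
  by_contra! hre
  have h1 : (p.γ + p.κ) / 2 ≤ ‖(p.γ + p.κ) / 2 + μ‖ := by
    refine le_trans ?_ (Complex.re_le_norm _)
    have : (((p.γ : ℂ) + p.κ) / 2).re = (p.γ + p.κ) / 2 := by
      rw [← Complex.ofReal_add, ← Complex.ofReal_ofNat, ← Complex.ofReal_div, Complex.ofReal_re]
    rw [Complex.add_re, this]
    linarith
  have h3 := norm_sub_norm_le ((((p.γ : ℂ) + p.κ) / 2 + μ) ^ 2) (((p.ε : ℂ) / 2) ^ 2)
  have h4 : ‖((p.ε : ℂ) / 2) ^ 2‖ = (p.ε / 2) ^ 2 := by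
    rw [norm_pow, ← Complex.ofReal_ofNat, ← Complex.ofReal_div, Complex.norm_real,
      Real.norm_eq_abs, sq_abs]
  rw [hnorm, norm_pow, h4] at h3
  have h5 := pow_le_pow_left₀ hd h1 2
  linarith

/-- If the two sides agreed, the `q`-quadratures would carry an explicit left null vector, nonzero
because its `b₁` entry is `ε/2`. -/
theorem ne_of_isUnit_matA_zero (p : Params) (hε : p.ε ≠ 0) (hA : IsUnit (matA p 0 0)) :
    ((p.γ + p.κ) / 2) ^ 2 - (p.ε / 2) ^ 2 ≠ p.α * p.γ * (p.ε / 2) := by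
  intro h
  rw [← Matrix.vecMul_injective_iff_isUnit] at hA
  have hv : ![(p.γ + p.κ) / 2, 0, p.ε / 2, 0, -(p.ε / 2), 0, -((p.γ + p.κ) / 2), 0] ᵥ* matA p 0 0
      = 0 ᵥ* matA p 0 0 := by
    rw [Matrix.zero_vecMul]
    ext j
    fin_cases j <;> simp [Matrix.vecMul, dotProduct, Fin.sum_univ_succ, matA]
    · linear_combination -h
    · ring
    · ring
    · linear_combination h
  have := congrFun (hA hv) 2
  simp [hε] at this

/-! ### Closed form of the spectra -/

/-- The determinant `((γ+κ)/2)² - (ε/2)²` of the drift of a single NOPA. -/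
def Params.Δ (p : Params) : ℝ := ((p.γ + p.κ) / 2) ^ 2 - (p.ε / 2) ^ 2

/-- The loop gain `αγε/2`. -/
def Params.T (p : Params) : ℝ := p.α * p.γ * (p.ε / 2)

/-- The constant `(γ² - κ² + ε²)/4`. -/
def Params.S (p : Params) : ℝ := (p.γ ^ 2 - p.κ ^ 2 + p.ε ^ 2) / 4

/-- The constant `((γ+κ)/2)⁴ - (ε/2)⁴ - α²γκ(ε/2)²`. -/
def Params.W (p : Params) : ℝ :=
  ((p.γ + p.κ) / 2) ^ 4 - (p.ε / 2) ^ 4 - p.α ^ 2 * p.γ * p.κ * (p.ε / 2) ^ 2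

/-- The phase-dependent factor of the squeezing spectra, for `a`, `b`, `c` the cosines of
`θ₁ + φ₁ + φ₂`, `θ₂ + φ₁ + φ₂` and `θ₁ - θ₂`. -/
def phaseFactor (Δ T a b c : ℝ) : ℝ :=
  (Δ ^ 2 + T ^ 2 - Δ * T * (a + b)) / (Δ ^ 4 + T ^ 4 - 2 * Δ ^ 2 * T ^ 2 * c)

/-- The contribution to `V₊` of the noises entering through one of the two output modes. -/
theorem mode_contribution (γ κ e α u v c s : ℝ) (hγ : γ ≠ 0) (he : e ≠ 0)
    (hcs : c ^ 2 + s ^ 2 = 1) :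
    ((γ - κ) / 2 * ((c + (γ + κ) / 2 * ((u - c) / γ)) / e) + e * ((u - c) / γ)) ^ 2
    + ((γ - κ) / 2 * ((s + (γ + κ) / 2 * ((v - s) / γ)) / e) + e * ((v - s) / γ)) ^ 2
    + γ * κ * (((c + (γ + κ) / 2 * ((u - c) / γ)) / e) ^ 2
      + ((s + (γ + κ) / 2 * ((v - s) / γ)) / e) ^ 2 + ((u - c) / γ) ^ 2 + ((v - s) / γ) ^ 2)
    + (1 - α ^ 2) * (u ^ 2 + v ^ 2) =
    ((((γ + κ) / 2) ^ 4 + (γ ^ 2 - κ ^ 2) / 2 * e ^ 2 + e ^ 4 + γ * κ * e ^ 2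
        + (1 - α ^ 2) * e ^ 2 * γ ^ 2) * (u ^ 2 + v ^ 2)
      + 2 * (((γ + κ) / 2) ^ 3 * ((γ - κ) / 2) - e ^ 4 - κ * e ^ 2 * ((γ - κ) / 2 + γ))
        * (u * c + v * s)
      + (((γ + κ) / 2) ^ 2 * ((γ - κ) / 2) ^ 2 - 2 * ((γ - κ) / 2) ^ 2 * e ^ 2 + e ^ 4
        + γ * κ * e ^ 2)) / (γ ^ 2 * e ^ 2) := by
  have h1 : s ^ 2 = 1 - c ^ 2 := by linarith
  field_simp
  ring_nf
  simp only [h1]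
  ring

theorem exp_conj_inv (θ : ℝ) :
    (starRingEnd ℂ) (Complex.exp (θ * Complex.I)) = (Complex.exp (θ * Complex.I))⁻¹ := by
  rw [← Complex.exp_conj, ← Complex.exp_neg]
  simp

/-- Solution of the two-mode equations for the output coefficients, with the two quadratic
invariants that enter `V₊`. -/
theorem exists_mode_solution (Δ T S θ₁ θ₂ φ₁ φ₂ : ℝ) (hΔ : Δ ≠ 0) (h : |Δ| ≠ |T|) :
    ∃ u₂ v₂ u₃ v₃ : ℝ,
      Δ * u₂ + T * (Real.cos θ₁ * u₃ - Real.sin θ₁ * v₃) = -(S * Real.cos φ₁) ∧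
      Δ * v₂ + T * (Real.cos θ₁ * v₃ + Real.sin θ₁ * u₃) = S * Real.sin φ₁ ∧
      Δ * u₃ + T * (Real.cos θ₂ * u₂ + Real.sin θ₂ * v₂) = -(S * Real.cos φ₂) ∧
      Δ * v₃ + T * (Real.cos θ₂ * v₂ - Real.sin θ₂ * u₂) = -(S * Real.sin φ₂) ∧
      (u₂ ^ 2 + v₂ ^ 2) + (u₃ ^ 2 + v₃ ^ 2) = 2 * S ^ 2 * phaseFactor Δ T
        (Real.cos (θ₁ + φ₁ + φ₂)) (Real.cos (θ₂ + φ₁ + φ₂)) (Real.cos (θ₁ - θ₂)) ∧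
      (u₂ * Real.cos φ₁ + v₂ * (-Real.sin φ₁)) + (u₃ * Real.cos φ₂ + v₃ * Real.sin φ₂) =
        -(S / Δ) * (1 + (Δ ^ 2 - T ^ 2) * phaseFactor Δ T
        (Real.cos (θ₁ + φ₁ + φ₂)) (Real.cos (θ₂ + φ₁ + φ₂)) (Real.cos (θ₁ - θ₂))) := by
  have hΔ' : (Δ : ℂ) ≠ 0 := by exact_mod_cast hΔ
  -- With `h₂ = u₂ + i v₂` and `h₃ = u₃ + i v₃`, the four real equations become two complex ones.
  set w₁ := Complex.exp (θ₁ * Complex.I) with hw₁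
  set w₂ := Complex.exp (((-θ₂ : ℝ) : ℂ) * Complex.I) with hw₂
  set f₁ := Complex.exp (((-φ₁ : ℝ) : ℂ) * Complex.I) with hf₁
  set f₂ := Complex.exp (φ₂ * Complex.I) with hf₂
  have w₁0 : w₁ ≠ 0 := Complex.exp_ne_zero _
  have w₂0 : w₂ ≠ 0 := Complex.exp_ne_zero _
  have f₁0 : f₁ ≠ 0 := Complex.exp_ne_zero _
  have f₂0 : f₂ ≠ 0 := Complex.exp_ne_zero _
  have cw₁ : (starRingEnd ℂ) w₁ = w₁⁻¹ := exp_conj_inv _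
  have cw₂ : (starRingEnd ℂ) w₂ = w₂⁻¹ := exp_conj_inv _
  have cf₁ : (starRingEnd ℂ) f₁ = f₁⁻¹ := exp_conj_inv _
  have cf₂ : (starRingEnd ℂ) f₂ = f₂⁻¹ := exp_conj_inv _
  have rw₁ : w₁.re = Real.cos θ₁ := Complex.exp_ofReal_mul_I_re _
  have iw₁ : w₁.im = Real.sin θ₁ := Complex.exp_ofReal_mul_I_im _
  have rw₂ : w₂.re = Real.cos θ₂ := by rw [hw₂, Complex.exp_ofReal_mul_I_re, Real.cos_neg]
  have iw₂ : w₂.im = -Real.sin θ₂ := by rw [hw₂, Complex.exp_ofReal_mul_I_im, Real.sin_neg]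
  have rf₁ : f₁.re = Real.cos φ₁ := by rw [hf₁, Complex.exp_ofReal_mul_I_re, Real.cos_neg]
  have if₁ : f₁.im = -Real.sin φ₁ := by rw [hf₁, Complex.exp_ofReal_mul_I_im, Real.sin_neg]
  have rf₂ : f₂.re = Real.cos φ₂ := Complex.exp_ofReal_mul_I_re _
  have if₂ : f₂.im = Real.sin φ₂ := Complex.exp_ofReal_mul_I_im _
  have hN : (Δ : ℂ) ^ 2 - T ^ 2 * w₁ * w₂ ≠ 0 := by
    intro h0
    apply h
    have := congrArg norm (sub_eq_zero.1 h0)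
    rw [norm_mul, norm_mul, hw₁, hw₂, Complex.norm_exp_ofReal_mul_I,
      Complex.norm_exp_ofReal_mul_I, norm_pow, norm_pow, Complex.norm_real, Complex.norm_real,
      mul_one, mul_one] at this
    exact (sq_eq_sq₀ (abs_nonneg _) (abs_nonneg _)).1 this
  have hN' : (Δ : ℂ) ^ 2 * (w₁ * w₂) - T ^ 2 ≠ 0 := by
    intro h0
    apply hN
    have : (starRingEnd ℂ) ((Δ : ℂ) ^ 2 - T ^ 2 * w₁ * w₂) = 0 := by
      simp only [map_sub, map_mul, map_pow, Complex.conj_ofReal, cw₁, cw₂]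
      field_simp
      linear_combination h0
    exact (map_eq_zero _).1 this
  have cos₁ : ((Real.cos (θ₁ + φ₁ + φ₂) : ℝ) : ℂ) =
      (w₁ * f₂ * f₁⁻¹ + w₁⁻¹ * f₂⁻¹ * f₁) / 2 := by
    rw [Complex.ofReal_cos, Complex.cos, hw₁, hf₁, hf₂]
    simp only [← Complex.exp_neg, ← Complex.exp_add]
    push_cast
    ring_nf
  have cos₂ : ((Real.cos (θ₂ + φ₁ + φ₂) : ℝ) : ℂ) =
      (w₂ * f₁ * f₂⁻¹ + w₂⁻¹ * f₁⁻¹ * f₂) / 2 := by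
    rw [Complex.ofReal_cos, Complex.cos, hw₂, hf₁, hf₂]
    simp only [← Complex.exp_neg, ← Complex.exp_add]
    push_cast
    ring_nf
  have cos₃ : ((Real.cos (θ₁ - θ₂) : ℝ) : ℂ) = (w₁ * w₂ + w₁⁻¹ * w₂⁻¹) / 2 := by
    rw [Complex.ofReal_cos, Complex.cos, hw₁, hw₂]
    simp only [← Complex.exp_neg, ← Complex.exp_add]
    push_cast
    ring_nf
  obtain ⟨n, hn⟩ : ∃ n, n = (Δ : ℂ) ^ 2 - T ^ 2 * w₁ * w₂ := ⟨_, rfl⟩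
  obtain ⟨n', hn'⟩ : ∃ n', n' = (Δ : ℂ) ^ 2 * (w₁ * w₂) - T ^ 2 := ⟨_, rfl⟩
  rw [← hn] at hN
  rw [← hn'] at hN'
  -- `n'/(w₁w₂)` is the conjugate of `n`, so the denominator of `phaseFactor` is `|n|²`.
  have hden : (Δ : ℂ) ^ 4 + T ^ 4 - 2 * Δ ^ 2 * T ^ 2 * ((w₁ * w₂ + w₁⁻¹ * w₂⁻¹) / 2) =
      n * n' / (w₁ * w₂) := by
    rw [hn, hn']
    field_simp
    ring
  -- Cramer's rule, with determinant `n`.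
  obtain ⟨h₂, hh₂⟩ : ∃ z, z = -S * (Δ * f₁ - T * w₁ * f₂) / n := ⟨_, rfl⟩
  obtain ⟨h₃, hh₃⟩ : ∃ z, z = -S * (Δ * f₂ - T * w₂ * f₁) / n := ⟨_, rfl⟩
  have E₁ : Δ * h₂ + T * w₁ * h₃ = -S * f₁ := by
    rw [hh₂, hh₃]; field_simp; rw [hn]; ring
  have E₂ : Δ * h₃ + T * w₂ * h₂ = -S * f₂ := by
    rw [hh₂, hh₃]; field_simp; rw [hn]; ring
  have ch₂ : (starRingEnd ℂ) h₂ = -S * (Δ * f₁⁻¹ - T * w₁⁻¹ * f₂⁻¹) * (w₁ * w₂) / n' := by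
    rw [hh₂, hn, hn']
    simp only [map_div₀, map_sub, map_mul, map_pow, map_neg, Complex.conj_ofReal, cw₁, cw₂, cf₁,
      cf₂]
    rw [show (Δ : ℂ) ^ 2 - T ^ 2 * w₁⁻¹ * w₂⁻¹ = (Δ ^ 2 * (w₁ * w₂) - T ^ 2) / (w₁ * w₂) by
      field_simp, div_div_eq_mul_div]
  have ch₃ : (starRingEnd ℂ) h₃ = -S * (Δ * f₂⁻¹ - T * w₂⁻¹ * f₁⁻¹) * (w₁ * w₂) / n' := by
    rw [hh₃, hn, hn']
    simp only [map_div₀, map_sub, map_mul, map_pow, map_neg, Complex.conj_ofReal, cw₁, cw₂, cf₁,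
      cf₂]
    rw [show (Δ : ℂ) ^ 2 - T ^ 2 * w₁⁻¹ * w₂⁻¹ = (Δ ^ 2 * (w₁ * w₂) - T ^ 2) / (w₁ * w₂) by
      field_simp, div_div_eq_mul_div]
  have E₁r := congrArg Complex.re E₁
  have E₁i := congrArg Complex.im E₁
  have E₂r := congrArg Complex.re E₂
  have E₂i := congrArg Complex.im E₂
  simp [rw₁, iw₁, rw₂, iw₂, rf₁, if₁, rf₂, if₂] at E₁r E₁i E₂r E₂i
  refine ⟨h₂.re, h₂.im, h₃.re, h₃.im, by linarith, by linarith, by linarith, by linarith, ?_, ?_⟩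
  · have key : ((h₂.re ^ 2 + h₂.im ^ 2 + (h₃.re ^ 2 + h₃.im ^ 2) : ℝ) : ℂ) =
        h₂ * (starRingEnd ℂ) h₂ + h₃ * (starRingEnd ℂ) h₃ := by
      rw [Complex.mul_conj, Complex.mul_conj, Complex.normSq_apply, Complex.normSq_apply]
      push_cast
      ring
    apply Complex.ofReal_injective
    rw [key, phaseFactor, ch₂, ch₃, hh₂, hh₃]
    push_cast [cos₁, cos₂, cos₃, -Complex.ofReal_cos]
    rw [hden]
    field_simp
    ring
  · have key : ((h₂.re * Real.cos φ₁ + h₂.im * (-Real.sin φ₁)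
        + (h₃.re * Real.cos φ₂ + h₃.im * Real.sin φ₂) : ℝ) : ℂ) =
        (h₂ * f₁⁻¹ + (starRingEnd ℂ) h₂ * f₁ + (h₃ * f₂⁻¹ + (starRingEnd ℂ) h₃ * f₂)) / 2 := by
      rw [← cf₁, ← cf₂, ← rf₁, ← if₁, ← rf₂, ← if₂]
      apply Complex.ext
      · simp
        ring
      · simp
        ring
    apply Complex.ofReal_injective
    rw [key, phaseFactor, ch₂, ch₃, hh₂, hh₃]
    push_cast [cos₁, cos₂, cos₃, -Complex.ofReal_cos]
    rw [hden]
    field_simp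
    rw [hn, hn']
    ring

/-- Both invariants of `exists_mode_solution` are affine in the same phase factor, hence so is `V₊`.
-/
theorem Vplus_eq (p : Params) (θ₁ θ₂ φ₁ φ₂ : ℝ) (hγ : 0 < p.γ) (hκ : 0 ≤ p.κ) (hε : p.ε ≠ 0)
    (hα : p.α ^ 2 ≤ 1) (hΔ : p.Δ ≠ 0) (h : |p.Δ| ≠ |p.T|) :
    Vplus p θ₁ θ₂ φ₁ φ₂ =
      4 * p.S * p.W / p.Δ * phaseFactor p.Δ p.T
        (Real.cos (θ₁ + φ₁ + φ₂)) (Real.cos (θ₂ + φ₁ + φ₂)) (Real.cos (θ₁ - θ₂))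
      + 2 * ((p.ε / 2) ^ 2 - (p.γ + p.κ) / 2 * ((p.γ - 3 * p.κ) / 2)) / p.Δ := by
  obtain ⟨u₂, v₂, u₃, v₃, e₁, e₂, e₃, e₄, hsq, hre⟩ :=
    exists_mode_solution p.Δ p.T p.S θ₁ θ₂ φ₁ φ₂ hΔ h
  have hγ0 := hγ.ne'
  have he : p.ε / 2 ≠ 0 := div_ne_zero hε two_ne_zero
  -- `u` and `v` are the beamsplitter noise amplitudes, such as `u₂ = cos φ₁ + γ x₂`. Inverting this
  -- gives the `b₁`, `a₂` coefficients; the pump equations `h₂`–`h₃'` then give those of `a₁`, `b₂`.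
  rw [Vplus_eq_of_solution p θ₁ θ₂ φ₁ φ₂
    ((Real.cos φ₁ + (p.γ + p.κ) / 2 * ((u₂ - Real.cos φ₁) / p.γ)) / (p.ε / 2))
    ((-Real.sin φ₁ + (p.γ + p.κ) / 2 * ((v₂ - -Real.sin φ₁) / p.γ)) / (p.ε / 2))
    ((u₂ - Real.cos φ₁) / p.γ) ((v₂ - -Real.sin φ₁) / p.γ)
    ((u₃ - Real.cos φ₂) / p.γ) ((v₃ - Real.sin φ₂) / p.γ)
    ((Real.cos φ₂ + (p.γ + p.κ) / 2 * ((u₃ - Real.cos φ₂) / p.γ)) / (p.ε / 2))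
    ((Real.sin φ₂ + (p.γ + p.κ) / 2 * ((v₃ - Real.sin φ₂) / p.γ)) / (p.ε / 2))
    hγ.le hκ hα (isUnit_matA p θ₁ θ₂ hε h)]
  · have m₂ := mode_contribution p.γ p.κ (p.ε / 2) p.α u₂ v₂ (Real.cos φ₁) (-Real.sin φ₁) hγ0 he
      (by rw [neg_sq]; exact Real.cos_sq_add_sin_sq φ₁)
    have m₃ := mode_contribution p.γ p.κ (p.ε / 2) p.α u₃ v₃ (Real.cos φ₂) (Real.sin φ₂) hγ0 he
      (Real.cos_sq_add_sin_sq φ₂)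
    have hX : ∀ a b : ℝ, a + p.γ * ((b - a) / p.γ) = b := fun a b => by field_simp; ring
    have hY : p.γ * ((v₂ - -Real.sin φ₁) / p.γ) - Real.sin φ₁ = v₂ := by field_simp; ring
    rw [hX, hX, hX, hY]
    refine Eq.trans ?_ ((congrArg₂ (· + ·) m₂ m₃).trans ?_)
    · ring
    · rw [← add_div]
      generalize phaseFactor _ _ _ _ _ = Y at hsq hre ⊢
      set P := ((p.γ + p.κ) / 2) ^ 4 + (p.γ ^ 2 - p.κ ^ 2) / 2 * (p.ε / 2) ^ 2 + (p.ε / 2) ^ 4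
        + p.γ * p.κ * (p.ε / 2) ^ 2 + (1 - p.α ^ 2) * (p.ε / 2) ^ 2 * p.γ ^ 2 with hP
      set c := ((p.γ + p.κ) / 2) ^ 3 * ((p.γ - p.κ) / 2) - (p.ε / 2) ^ 4
        - p.κ * (p.ε / 2) ^ 2 * ((p.γ - p.κ) / 2 + p.γ) with hc
      set R := ((p.γ + p.κ) / 2) ^ 2 * ((p.γ - p.κ) / 2) ^ 2
        - 2 * ((p.γ - p.κ) / 2) ^ 2 * (p.ε / 2) ^ 2 + (p.ε / 2) ^ 4 + p.γ * p.κ * (p.ε / 2) ^ 2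
        with hR
      have hsum : P * (u₂ ^ 2 + v₂ ^ 2) + 2 * c * (u₂ * Real.cos φ₁ + v₂ * -Real.sin φ₁) + R
          + (P * (u₃ ^ 2 + v₃ ^ 2) + 2 * c * (u₃ * Real.cos φ₂ + v₃ * Real.sin φ₂) + R)
          = P * (2 * p.S ^ 2 * Y) + 2 * c * (-(p.S / p.Δ) * (1 + (p.Δ ^ 2 - p.T ^ 2) * Y))
            + 2 * R := by
        rw [← hsq, ← hre]
        ring
      -- This factorization and the next cancel the common denominator `γ²(ε/2)²`.
      have hY₁ : P * p.S * p.Δ - c * (p.Δ ^ 2 - p.T ^ 2) =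
          2 * p.γ ^ 2 * (p.ε / 2) ^ 2 * p.W := by
        simp only [hP, hc, Params.Δ, Params.T, Params.S, Params.W]
        ring
      have hY₀ : R * p.Δ - c * p.S =
          p.γ ^ 2 * (p.ε / 2) ^ 2
            * ((p.ε / 2) ^ 2 - (p.γ + p.κ) / 2 * ((p.γ - 3 * p.κ) / 2)) := by
        simp only [hR, hc, Params.Δ, Params.S]
        ring
      rw [hsum, div_eq_iff (by positivity)]
      have hsplit : P * (2 * p.S ^ 2 * Y)
          + 2 * c * (-(p.S / p.Δ) * (1 + (p.Δ ^ 2 - p.T ^ 2) * Y)) + 2 * R =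
          (2 * p.S * Y * (P * p.S * p.Δ - c * (p.Δ ^ 2 - p.T ^ 2)) + 2 * (R * p.Δ - c * p.S))
            / p.Δ := by
        field_simp
        ring
      rw [hsplit, hY₁, hY₀]
      ring
  all_goals simp only [Params.Δ, Params.T, Params.S] at e₁ e₂ e₃ e₄
  · rw [Real.cos_add]
    field_simp
    linear_combination -4 * e₁
  · rw [Real.sin_add]
    field_simp
    linear_combination -4 * e₂
  · field_simp
    ring
  · field_simp
    ring
  · field_simp
    ring
  · field_simp
    ring
  · rw [Real.cos_add]
    field_simp
    linear_combination -4 * e₃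
  · rw [Real.sin_add]
    field_simp
    linear_combination -4 * e₄

/-! ### Minimizing the phase factor -/

theorem phaseFactor_den_pos {Δ T : ℝ} (hΔ : 0 < Δ) (hT : 0 < T) (hne : Δ ≠ T) (θ : ℝ) :
    0 < Δ ^ 4 + T ^ 4 - 2 * Δ ^ 2 * T ^ 2 * Real.cos θ := by
  have h1 : 0 < (Δ - T) ^ 2 := by
    have := sub_ne_zero.2 hne
    positivity
  have h2 : 0 < (Δ - T) ^ 2 * (Δ + T) ^ 2 := by positivity
  have h3 : 0 ≤ 2 * Δ ^ 2 * T ^ 2 * (1 - Real.cos θ) :=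
    mul_nonneg (by positivity) (by linarith [Real.cos_le_one θ])
  linarith [show (Δ - T) ^ 2 * (Δ + T) ^ 2 + 2 * Δ ^ 2 * T ^ 2 * (1 - Real.cos θ)
    = Δ ^ 4 + T ^ 4 - 2 * Δ ^ 2 * T ^ 2 * Real.cos θ by ring]

theorem phaseFactor_one {Δ T : ℝ} (hΔ : 0 < Δ) (hT : 0 < T) (hne : Δ ≠ T) :
    phaseFactor Δ T 1 1 1 = 1 / (Δ + T) ^ 2 := by
  have h1 := (phaseFactor_den_pos hΔ hT hne 0).ne'
  rw [Real.cos_zero] at h1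
  have h2 : (Δ + T) ^ 2 ≠ 0 := by positivity
  rw [phaseFactor, div_eq_div_iff h1 h2]
  ring

/-- The excess of the phase factor over its minimum, with `z` the mean of `cos θ₁` and `cos θ₂`. -/
theorem phaseFactor_sub_one {Δ T : ℝ} (hΔ : 0 < Δ) (hT : 0 < T) (hne : Δ ≠ T) (θ₁ θ₂ : ℝ) :
    ∃ q, 0 ≤ q ∧ phaseFactor Δ T (Real.cos θ₁) (Real.cos θ₂) (Real.cos (θ₁ - θ₂))
        - phaseFactor Δ T 1 1 1 =
      2 * Δ * T * ((Δ - T) ^ 2 * (1 - (Real.cos θ₁ + Real.cos θ₂) / 2) + q) /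
        ((Δ ^ 4 + T ^ 4 - 2 * Δ ^ 2 * T ^ 2 * Real.cos (θ₁ - θ₂)) * (Δ + T) ^ 2) := by
  have h1 := (phaseFactor_den_pos hΔ hT hne (θ₁ - θ₂)).ne'
  have h2 : (Δ + T) ^ 2 ≠ 0 := by positivity
  set z := (Real.cos θ₁ + Real.cos θ₂) / 2 with hz
  have hsum : Real.cos θ₁ + Real.cos θ₂ = 2 * z := by rw [hz]; ring
  have hz' : z = Real.cos ((θ₁ + θ₂) / 2) * Real.cos ((θ₁ - θ₂) / 2) := by
    rw [hz, Real.cos_add_cos]; ring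
  have hC : Real.cos (θ₁ - θ₂) = 2 * Real.cos ((θ₁ - θ₂) / 2) ^ 2 - 1 := by
    rw [← Real.cos_two_mul]; congr 1; ring
  -- What remains of the cross-multiplied difference after splitting off `(Δ - T)²(1 - z)`; it is
  -- nonnegative because `z` is `cos((θ₁-θ₂)/2)` times another cosine.
  refine ⟨2 * Δ * T * (Real.cos ((θ₁ - θ₂) / 2) ^ 2 - z ^ 2 + (1 - z) ^ 2), ?_, ?_⟩
  · refine mul_nonneg (by positivity) (add_nonneg ?_ (sq_nonneg _))
    have : Real.cos ((θ₁ - θ₂) / 2) ^ 2 - z ^ 2 =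
        Real.cos ((θ₁ - θ₂) / 2) ^ 2 * (1 - Real.cos ((θ₁ + θ₂) / 2) ^ 2) := by
      rw [hz']; ring
    rw [this]
    exact mul_nonneg (sq_nonneg _) (by linarith [Real.cos_sq_le_one ((θ₁ + θ₂) / 2)])
  · rw [phaseFactor_one hΔ hT hne, phaseFactor, hsum, div_sub_div _ _ h1 h2]
    congr 1
    rw [hC]
    ring

theorem phaseFactor_one_le {Δ T : ℝ} (hΔ : 0 < Δ) (hT : 0 < T) (hne : Δ ≠ T) (θ₁ θ₂ : ℝ) :
    phaseFactor Δ T 1 1 1 ≤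
      phaseFactor Δ T (Real.cos θ₁) (Real.cos θ₂) (Real.cos (θ₁ - θ₂)) := by
  obtain ⟨q, hq, h⟩ := phaseFactor_sub_one hΔ hT hne θ₁ θ₂
  have h1 := phaseFactor_den_pos hΔ hT hne (θ₁ - θ₂)
  have hz : 0 ≤ 1 - (Real.cos θ₁ + Real.cos θ₂) / 2 := by
    linarith [Real.cos_le_one θ₁, Real.cos_le_one θ₂]
  rw [← sub_nonneg, h]
  positivity

/-- As `(Δ - T)² > 0`, equality forces the mean of the two cosines to be 1, hence each cosine to be
1. -/
theorem phaseFactor_eq_one_iff {Δ T : ℝ} (hΔ : 0 < Δ) (hT : 0 < T) (hne : Δ ≠ T) {θ₁ θ₂ : ℝ}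
    (hθ₁ : θ₁ ∈ Set.Ioc (-Real.pi) Real.pi) (hθ₂ : θ₂ ∈ Set.Ioc (-Real.pi) Real.pi) :
    phaseFactor Δ T (Real.cos θ₁) (Real.cos θ₂) (Real.cos (θ₁ - θ₂)) = phaseFactor Δ T 1 1 1 ↔
      θ₁ = 0 ∧ θ₂ = 0 := by
  refine ⟨fun heq => ?_, ?_⟩
  · obtain ⟨q, hq, h⟩ := phaseFactor_sub_one hΔ hT hne θ₁ θ₂
    have h1 := phaseFactor_den_pos hΔ hT hne (θ₁ - θ₂)
    have hz : 1 - (Real.cos θ₁ + Real.cos θ₂) / 2 = 0 := by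
      by_contra hz0
      have hz : 0 < 1 - (Real.cos θ₁ + Real.cos θ₂) / 2 :=
        lt_of_le_of_ne (by linarith [Real.cos_le_one θ₁, Real.cos_le_one θ₂]) (Ne.symm hz0)
      have h2 : 0 < (Δ - T) ^ 2 := by
        have := sub_ne_zero.2 hne
        positivity
      rw [heq, sub_self] at h
      refine absurd h (ne_of_lt ?_)
      positivity
    have hcos : ∀ θ ∈ Set.Ioc (-Real.pi) Real.pi, 1 ≤ Real.cos θ → θ = 0 := fun θ hθ hc =>
      (Real.cos_eq_one_iff_of_lt_of_lt (by linarith [hθ.1, Real.pi_pos])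
        (by linarith [hθ.2, Real.pi_pos])).1 (le_antisymm (Real.cos_le_one θ) hc)
    exact ⟨hcos θ₁ hθ₁ (by linarith [Real.cos_le_one θ₂]),
      hcos θ₂ hθ₂ (by linarith [Real.cos_le_one θ₁])⟩
  · rintro ⟨rfl, rfl⟩
    simp

/-! ### Signs of the constants and the minimality of the spectra -/

theorem Params.Δ_pos (p : Params) (hε : 0 < p.ε) (hεγ : p.ε ≤ p.γ) (hκ : 0 < p.κ) : 0 < p.Δ := by
  rw [Params.Δ, sub_pos]
  exact pow_lt_pow_left₀ (by linarith) (by linarith) two_ne_zero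

theorem Params.S_pos (p : Params) (hε : 0 < p.ε) (hκ : 0 < p.κ) (hκγ : p.κ ≤ p.γ) : 0 < p.S := by
  have := pow_le_pow_left₀ hκ.le hκγ 2
  have := pow_pos hε 2
  rw [Params.S]
  linarith

/-- The negative terms are largest at `ε = γ`, `α = 1`, where they cancel exactly the two leading
terms of `((γ+κ)/2)⁴` as a polynomial in `κ`. -/
theorem Params.W_pos (p : Params) (hε : 0 < p.ε) (hεγ : p.ε ≤ p.γ) (hκ : 0 < p.κ)
    (hα : p.α ^ 2 ≤ 1) : 0 < p.W := by
  have hγ : 0 < p.γ := hε.trans_le hεγ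
  have h2 : (p.ε / 2) ^ 2 ≤ (p.γ / 2) ^ 2 := pow_le_pow_left₀ (by linarith) (by linarith) 2
  have h4 : (p.ε / 2) ^ 4 ≤ (p.γ / 2) ^ 4 := pow_le_pow_left₀ (by linarith) (by linarith) 4
  have hc : p.α ^ 2 * p.γ * p.κ * (p.ε / 2) ^ 2 ≤ 1 * p.γ * p.κ * (p.γ / 2) ^ 2 := by gcongr
  have hrest : 0 < (p.γ / 2) ^ 2 * p.κ ^ 2 / 2 + (p.γ * p.κ / 2 + p.κ ^ 2 / 4) ^ 2 := by positivity
  rw [Params.W]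
  linarith [show ((p.γ + p.κ) / 2) ^ 4 = (p.γ / 2) ^ 4 + 1 * p.γ * p.κ * (p.γ / 2) ^ 2
    + ((p.γ / 2) ^ 2 * p.κ ^ 2 / 2 + (p.γ * p.κ / 2 + p.κ ^ 2 / 4) ^ 2) by ring]

theorem params_bounds {x y α : ℝ} (hx : x ∈ Set.Ioc (0 : ℝ) 1) (hy : y ∈ Set.Ioc (0 : ℝ) 1) :
    0 < (params x y α).ε ∧ (params x y α).ε ≤ (params x y α).γ ∧ 0 < (params x y α).κ ∧
      (params x y α).κ ≤ (params x y α).γ := by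
  have hx0 := hx.1
  have hy0 := hy.1
  have hγ : gammaRef ≤ gammaRef / y :=
    le_div_self (by norm_num [gammaRef]) hy.1 hy.2
  have h2 : (1 : ℝ) ≤ √2 := Real.one_le_sqrt.2 (by norm_num)
  refine ⟨mul_pos hx.1 (by norm_num [gammaRef]), le_trans ?_ hγ, ?_, le_trans ?_ hγ⟩
  · exact mul_le_of_le_one_left (by norm_num [gammaRef]) hx.2
  · simp only [params]
    positivity
  · simp only [params, gammaRef]
    have : 3 * 10 ^ 6 / (√2 * (6 / 10)) ≤ 5000000 := by
      rw [div_le_iff₀ (by positivity)]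
      linarith
    calc 3 * 10 ^ 6 / (√2 * (6 / 10)) * x ≤ 5000000 * 1 := by
          gcongr
          exact hx.2
      _ ≤ 72000000 := by norm_num

theorem squeezing_minimal (p : Params) (hε : 0 < p.ε) (hεγ : p.ε ≤ p.γ) (hκ : 0 < p.κ)
    (hκγ : p.κ ≤ p.γ) (hα : 0 < p.α) (hα1 : p.α ≤ 1) (hA : IsUnit (matA p 0 0)) {θ₁ θ₂ : ℝ}
    (hθ₁ : θ₁ ∈ Set.Ioc (-Real.pi) Real.pi) (hθ₂ : θ₂ ∈ Set.Ioc (-Real.pi) Real.pi) :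
    VnopsPlus p ≤ VpsPlus p θ₁ θ₂ ∧ (VpsPlus p θ₁ θ₂ = VnopsPlus p ↔ θ₁ = 0 ∧ θ₂ = 0) := by
  have hγ : 0 < p.γ := hε.trans_le hεγ
  have hΔ := p.Δ_pos hε hεγ hκ
  have hS := p.S_pos hε hκ hκγ
  have hα2 : p.α ^ 2 ≤ 1 := pow_le_one₀ hα.le hα1
  have hW := p.W_pos hε hεγ hκ hα2
  have hT : 0 < p.T := by rw [Params.T]; positivity
  have hne : p.Δ ≠ p.T := ne_of_isUnit_matA_zero p hε.ne' hA
  have habs : |p.Δ| ≠ |p.T| := by rwa [abs_of_pos hΔ, abs_of_pos hT]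
  have hK : 0 < 4 * p.S * p.W / p.Δ := by positivity
  rw [VpsPlus, VnopsPlus, Vplus_eq p θ₁ θ₂ 0 0 hγ hκ.le hε.ne' hα2 hΔ.ne' habs,
    Vplus_eq p 0 0 0 0 hγ hκ.le hε.ne' hα2 hΔ.ne' habs]
  simp only [add_zero, sub_zero, Real.cos_zero]
  rw [add_le_add_iff_right, mul_le_mul_iff_right₀ hK, add_left_inj, mul_right_inj' hK.ne']
  exact ⟨phaseFactor_one_le hΔ hT hne θ₁ θ₂, phaseFactor_eq_one_iff hΔ hT hne hθ₁ hθ₂⟩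

/-- The opposite quarter turns cancel in `φ₁ + φ₂`. -/
theorem Vminus_eq_Vplus_self (p : Params) (θ₁ θ₂ φ₁ φ₂ : ℝ) (hγ : 0 < p.γ) (hκ : 0 ≤ p.κ)
    (hε : p.ε ≠ 0) (hα : p.α ^ 2 ≤ 1) (hΔ : p.Δ ≠ 0) (h : |p.Δ| ≠ |p.T|) :
    Vminus p θ₁ θ₂ φ₁ φ₂ = Vplus p θ₁ θ₂ φ₁ φ₂ := by
  rw [Vminus_eq_Vplus, Vplus_eq p θ₁ θ₂ _ _ hγ hκ hε hα hΔ h, Vplus_eq p θ₁ θ₂ _ _ hγ hκ hε hα hΔ h]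
  rw [show θ₁ + (φ₁ - Real.pi / 2) + (φ₂ + Real.pi / 2) = θ₁ + φ₁ + φ₂ by ring,
    show θ₂ + (φ₁ - Real.pi / 2) + (φ₂ + Real.pi / 2) = θ₂ + φ₁ + φ₂ by ring]

/-! ### Loss of entanglement at an explicit point -/

/-- The choice `x = √2/10` cancels the `√2` in `κ`, giving `κ = 500000`. Of the constants used, only
`ε` and `T` stay irrational. -/
theorem entanglement_destroyed :
    IsStable (params (√2 / 10) 1 1) 0 0 ∧
    IsStable (params (√2 / 10) 1 1) (Real.pi / 2) (-(Real.pi / 2)) ∧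
    EPREntangled (params (√2 / 10) 1 1) 0 0 ∧
    ¬ EPREntangled (params (√2 / 10) 1 1) (Real.pi / 2) (-(Real.pi / 2)) := by
  have s2 : √2 ^ 2 = 2 := Real.sq_sqrt (by norm_num)
  have s2lt : √2 < 3 / 2 := (Real.sqrt_lt' (by norm_num)).2 (by norm_num)
  have s2gt : 7 / 5 < √2 := (Real.lt_sqrt (by norm_num)).2 (by norm_num)
  have hs4 : √2 ^ 4 = 4 := by rw [show √2 ^ 4 = (√2 ^ 2) ^ 2 by ring, s2]; norm_num
  set p := params (√2 / 10) 1 1 with hp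
  have pγ : p.γ = 72000000 := by norm_num [hp, params, gammaRef]
  have pε : p.ε = 7200000 * √2 := by simp only [hp, params, gammaRef]; ring
  have pκ : p.κ = 500000 := by
    simp only [hp, params]
    field_simp
    norm_num
  have pα : p.α = 1 := rfl
  have hε : 0 < p.ε := by rw [pε]; positivity
  have hΔe : p.Δ = 36250000 ^ 2 - 2 * 3600000 ^ 2 := by
    rw [Params.Δ, pγ, pκ, pε]
    linear_combination -3600000 ^ 2 * s2
  have hTe : p.T = 72000000 * 3600000 * √2 := by
    rw [Params.T, pγ, pα, pε]; ring
  have hSe : p.S = (72000000 ^ 2 - 500000 ^ 2 + 2 * 7200000 ^ 2) / 4 := by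
    rw [Params.S, pγ, pκ, pε]
    linear_combination 7200000 ^ 2 / 4 * s2
  have hWe : p.W = 36250000 ^ 4 - 4 * 3600000 ^ 4
      - 72000000 * 500000 * (2 * 3600000 ^ 2) := by
    rw [Params.W, pγ, pκ, pα, pε]
    linear_combination -3600000 ^ 4 * hs4 - 72000000 * 500000 * 3600000 ^ 2 * s2
  have hΔ : 0 < p.Δ := by rw [hΔe]; norm_num
  have hT : 0 < p.T := by rw [hTe]; positivity
  have hTΔ : p.T < p.Δ := by
    rw [hTe, hΔe]
    linarith
  have habs : |p.Δ| ≠ |p.T| := by rw [abs_of_pos hΔ, abs_of_pos hT]; exact hTΔ.ne'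
  have hγ : 0 < p.γ := by rw [pγ]; norm_num
  have hκ : 0 ≤ p.κ := by rw [pκ]; norm_num
  have hα2 : p.α ^ 2 ≤ 1 := by rw [pα]; norm_num
  have hst : ∀ θ₁ θ₂, IsStable p θ₁ θ₂ := fun θ₁ θ₂ =>
    isStable_of_lt p θ₁ θ₂ hε.ne' (by positivity)
      (show |p.T| < p.Δ by rwa [abs_of_pos hT])
  have hK₀ : 2 * ((p.ε / 2) ^ 2 - (p.γ + p.κ) / 2 * ((p.γ - 3 * p.κ) / 2)) =
      2 * (2 * 3600000 ^ 2 - 36250000 * 35250000) := by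
    rw [pγ, pκ, pε]
    linear_combination 2 * 3600000 ^ 2 * s2
  refine ⟨hst _ _, hst _ _, ⟨0, ⟨by linarith [Real.pi_pos], Real.pi_pos.le⟩, 0,
    ⟨by linarith [Real.pi_pos], Real.pi_pos.le⟩, ?_⟩, ?_⟩
  · rw [Vminus_eq_Vplus_self p 0 0 0 0 hγ hκ hε.ne' hα2 hΔ.ne' habs,
      Vplus_eq p 0 0 0 0 hγ hκ hε.ne' hα2 hΔ.ne' habs]
    simp only [add_zero, sub_zero, Real.cos_zero]
    rw [phaseFactor_one hΔ hT hTΔ.ne', hK₀]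
    -- Replacing `√2` by the smaller `7/5` lowers `T`, so the rational value bounds the phase factor
    -- from above.
    have hlt : 1 / (p.Δ + p.T) ^ 2 < 1 / (36250000 ^ 2 - 2 * 3600000 ^ 2
        + 72000000 * 3600000 * (7 / 5)) ^ 2 := by
      rw [hΔe, hTe]
      gcongr
    have hK : 0 < 4 * p.S * p.W / p.Δ := by rw [hSe, hWe, hΔe]; norm_num
    have := mul_lt_mul_of_pos_left hlt hK
    rw [hSe, hWe, hΔe] at this ⊢
    norm_num at this ⊢
    linarith
  · rintro ⟨ψ₁, -, ψ₂, -, hlt⟩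
    rw [Vminus_eq_Vplus_self p _ _ _ _ hγ hκ hε.ne' hα2 hΔ.ne' habs,
      Vplus_eq p _ _ _ _ hγ hκ hε.ne' hα2 hΔ.ne' habs] at hlt
    have h1 : Real.cos (Real.pi / 2 + ψ₁ + ψ₂) = -Real.sin (ψ₁ + ψ₂) := by
      rw [show Real.pi / 2 + ψ₁ + ψ₂ = ψ₁ + ψ₂ + Real.pi / 2 by ring, Real.cos_add_pi_div_two]
    have h2 : Real.cos (-(Real.pi / 2) + ψ₁ + ψ₂) = Real.sin (ψ₁ + ψ₂) := by
      rw [show -(Real.pi / 2) + ψ₁ + ψ₂ = ψ₁ + ψ₂ - Real.pi / 2 by ring, Real.cos_sub_pi_div_two]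
    have h3 : Real.cos (Real.pi / 2 - -(Real.pi / 2)) = -1 := by
      rw [show Real.pi / 2 - -(Real.pi / 2) = Real.pi by ring, Real.cos_pi]
    have hT2 : p.T ^ 2 = 2 * (72000000 * 3600000) ^ 2 := by
      rw [hTe]; linear_combination (72000000 * 3600000) ^ 2 * s2
    -- The two sines cancel, so `ψ₁`, `ψ₂` drop out; `T` now enters only squared, and the claim is a
    -- rational inequality.
    have hpf : phaseFactor p.Δ p.T (-Real.sin (ψ₁ + ψ₂)) (Real.sin (ψ₁ + ψ₂)) (-1) =
        1 / (p.Δ ^ 2 + p.T ^ 2) := by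
      have : p.Δ ^ 4 + p.T ^ 4 - 2 * p.Δ ^ 2 * p.T ^ 2 * (-1) ≠ 0 := by
        have : 0 < p.Δ ^ 4 + p.T ^ 4 + 2 * p.Δ ^ 2 * p.T ^ 2 := by positivity
        linarith
      rw [phaseFactor, div_eq_div_iff this (by positivity)]
      ring
    rw [h1, h2, h3, hpf, hK₀, hT2, hSe, hWe, hΔe] at hlt
    norm_num at hlt

end DualNOPA

end

theorem mainTheorem5 :
    (∀ x y α θ₁ θ₂ : ℝ,
      x ∈ Set.Ioc (0 : ℝ) 1 → y ∈ Set.Ioc (0 : ℝ) 1 → α ∈ Set.Ioc (0 : ℝ) 1 →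
      θ₁ ∈ Set.Ioc (-Real.pi) Real.pi → θ₂ ∈ Set.Ioc (-Real.pi) Real.pi →
      IsUnit (DualNOPA.matA (DualNOPA.params x y α) 0 0) →
      (DualNOPA.VnopsPlus (DualNOPA.params x y α) ≤
          DualNOPA.VpsPlus (DualNOPA.params x y α) θ₁ θ₂ ∧
        (DualNOPA.VpsPlus (DualNOPA.params x y α) θ₁ θ₂ =
            DualNOPA.VnopsPlus (DualNOPA.params x y α) ↔ θ₁ = 0 ∧ θ₂ = 0)) ∧
      (DualNOPA.VnopsMinus (DualNOPA.params x y α) ≤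
          DualNOPA.VpsMinus (DualNOPA.params x y α) θ₁ θ₂ ∧
        (DualNOPA.VpsMinus (DualNOPA.params x y α) θ₁ θ₂ =
            DualNOPA.VnopsMinus (DualNOPA.params x y α) ↔ θ₁ = 0 ∧ θ₂ = 0))) ∧
    (∃ x ∈ Set.Ioc (0 : ℝ) 1, ∃ y ∈ Set.Ioc (0 : ℝ) 1, ∃ α ∈ Set.Ioc (0 : ℝ) 1,
      ∃ θ₁ ∈ Set.Ioc (-Real.pi) Real.pi, ∃ θ₂ ∈ Set.Ioc (-Real.pi) Real.pi,
      θ₁ ≠ 0 ∧ θ₂ ≠ 0 ∧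
      DualNOPA.IsStable (DualNOPA.params x y α) 0 0 ∧
      DualNOPA.IsStable (DualNOPA.params x y α) θ₁ θ₂ ∧
      DualNOPA.EPREntangled (DualNOPA.params x y α) 0 0 ∧
      ¬ DualNOPA.EPREntangled (DualNOPA.params x y α) θ₁ θ₂) := by
  refine ⟨fun x y α θ₁ θ₂ hx hy hα hθ₁ hθ₂ hA => ?_, ?_⟩
  · obtain ⟨hε, hεγ, hκ, hκγ⟩ := DualNOPA.params_bounds (α := α) hx hy
    have hα2 : α ^ 2 ≤ 1 := pow_le_one₀ hα.1.le hα.2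
    have hplus := DualNOPA.squeezing_minimal (DualNOPA.params x y α) hε hεγ hκ hκγ hα.1 hα.2 hA
      hθ₁ hθ₂
    have hΔ := (DualNOPA.params x y α).Δ_pos hε hεγ hκ
    have hγ := hε.trans_le hεγ
    have hT : 0 < (DualNOPA.params x y α).T :=
      mul_pos (mul_pos hα.1 hγ) (half_pos hε)
    have habs : |(DualNOPA.params x y α).Δ| ≠ |(DualNOPA.params x y α).T| := by
      rw [abs_of_pos hΔ, abs_of_pos hT]
      exact DualNOPA.ne_of_isUnit_matA_zero _ hε.ne' hA
    refine ⟨hplus, ?_⟩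
    rw [DualNOPA.VnopsMinus, DualNOPA.VpsMinus,
      DualNOPA.Vminus_eq_Vplus_self _ 0 0 0 0 hγ hκ.le hε.ne' hα2 hΔ.ne' habs,
      DualNOPA.Vminus_eq_Vplus_self _ θ₁ θ₂ 0 0 hγ hκ.le hε.ne' hα2 hΔ.ne' habs]
    exact hplus
  · have s2lt : √2 < 3 / 2 := (Real.sqrt_lt' (by norm_num)).2 (by norm_num)
    have hpi := Real.pi_pos
    exact ⟨√2 / 10, ⟨by positivity, by linarith⟩, 1, ⟨one_pos, le_rfl⟩, 1, ⟨one_pos, le_rfl⟩,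
      Real.pi / 2, ⟨by linarith, by linarith⟩, -(Real.pi / 2), ⟨by linarith, by linarith⟩,
      by positivity, by simp [hpi.ne'], DualNOPA.entanglement_destroyed⟩
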